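/- Let $d\ge 2$ and let $r$ be a positive integer with $r\notin\{1,2,4\}$. Regard $\mathbb{Z}^d$ as a graph in which $n,m$ are adjacent iff $\|n-m\|_1=1$; for $F\subset\mathbb{Z}^d$ let $\partial F$ be the set of vertices outside $F$ adjacent to a vertex of $F$. Let $X_r\subset(\mathbb{Z}/r\mathbb{Z})^{\mathbb{Z}^d}$ be the set of all configurations $(\hat x_n \bmod r)_{n\in\mathbb{Z}^d}$, where $\hat x:\mathbb{Z}^d\to\mathbb{Z}$ satisfies $|\hat x_n-\hat x_m|=1$ whenever $\|n-m\|_1=1$. Call $x,y\in X_r$ homoclinic if $x_n=y_n$ for all but finitely many $n$. Let $\mu$ be a Borel probability measure on $(\mathbb{Z}/r\mathbb{Z})^{\mathbb{Z}^d}$ (product topology) such that 1. $\mu$ is a Markov random field: for all finite $A,B\subset\mathbb{Z}^d$ with $\partial A\subset B\subset A^c$ and all $a\in(\mathbb{Z}/r\mathbb{Z})^A$, $b\in(\mathbb{Z}/r\mathbb{Z})^B$ with $\mu([b]_B)>0$, one has $\mu([a]_A\mid[b]_B)=\mu([a]_A\mid[b|_{\partial A}]_{\partial A})$, where $[c]_F$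 denotes the set of configurations whose restriction to $F$ is $c$; 2. $\mu$ is shift-invariant: $\mu$ is preserved by every shift $\sigma_n$, $n\in\mathbb{Z}^d$, where $(\sigma_n x)_m=x_{m+n}$; 3. $\mu$ is adapted with respect to $X_r$: $\mathrm{supp}(\mu)\subset X_r$, and if $x\in\mathrm{supp}(\mu)$ and $y\in X_r$ is homoclinic to $x$, then $y\in\mathrm{supp}(\mu)$. Then either $\mathrm{supp}(\mu)=X_r$, or $\mu$ is frozen, i.e. for every $x\in\mathrm{supp}(\mu)$ the only point of $X_r$ homoclinic to $x$ is $x$ itself. -/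

import Mathlib

open MeasureTheory ProbabilityTheory

namespace MRF

section General

variable {V : Type*} {α : Type*}

/-- The (outer) boundary of a set of vertices. -/
def boundary (G : SimpleGraph V) (F : Set V) : Set V :=
  {v | v ∉ F ∧ ∃ w ∈ F, G.Adj v w}

/-- The cylinder set `[x]_F` of all configurations that agree with `x` on `F`. Every pattern on `F`
is the restriction of some configuration `x` as soon as there are configurations at all. -/
def cylinder (F : Set V) (x : V → α) : Set (V → α) :=
  {y | ∀ v ∈ F, y v = x v}

/-- `μ` is a Markov random field on the graph `G`. Here `μ[s | t]` is the elementary conditional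
probability `μ (s ∩ t) / μ t`. -/
def IsMarkovRandomField [MeasurableSpace α] (G : SimpleGraph V) (μ : Measure (V → α)) : Prop :=
  IsProbabilityMeasure μ ∧
    ∀ A B : Finset V, boundary G (A : Set V) ⊆ (B : Set V) → Disjoint A B →
      ∀ a b : V → α, 0 < μ (cylinder (B : Set V) b) →
        μ[cylinder (A : Set V) a | cylinder (B : Set V) b] =
          μ[cylinder (A : Set V) a | cylinder (boundary G (A : Set V)) b]

/-- The homoclinic equivalence relation of `X`: both points lie in `X` and they agree at all but
finitely many vertices. -/
def Homoclinic (X : Set (V → α)) (x y : V → α) : Prop :=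
  x ∈ X ∧ y ∈ X ∧ {v | x v ≠ y v}.Finite

/-- `μ` is adapted with respect to `X`: its support is contained in `X` and contains, with each of
its points, the whole homoclinic class of this point in `X`. -/
def IsAdapted [TopologicalSpace α] [MeasurableSpace α]
    (X : Set (V → α)) (μ : Measure (V → α)) : Prop :=
  μ.support ⊆ X ∧ ∀ x ∈ μ.support, ∀ y, Homoclinic X x y → y ∈ μ.support

/-- `x` is a frozen point of `X`: its homoclinic class in `X` is the singleton `{x}`. -/
def IsFrozenPoint (X : Set (V → α)) (x : V → α) : Prop :=
  {y | Homoclinic X x y} = {x}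

/-- A measure on `X` is frozen if its support consists of frozen points of `X`. -/
def IsFrozen [TopologicalSpace α] [MeasurableSpace α]
    (X : Set (V → α)) (μ : Measure (V → α)) : Prop :=
  ∀ x ∈ μ.support, IsFrozenPoint X x

end General

/-- The standard Cayley graph of `ℤ^d`: adjacency means `ℓ¹`-distance one. -/
def lattice (d : ℕ) : SimpleGraph (Fin d → ℤ) where
  Adj n m := ∑ i, |n i - m i| = 1
  symm := ⟨fun n m h => by simpa only [abs_sub_comm] using h⟩
  loopless := ⟨fun n h => by simp at h⟩

/-- The shift `σ_n`, `(σ_n x)_m = x_{m + n}`. -/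
def shift {d : ℕ} {α : Type*} (n : Fin d → ℤ) (x : (Fin d → ℤ) → α) : (Fin d → ℤ) → α :=
  fun m => x (m + n)

/-- Invariance of a measure under all shifts. -/
def IsShiftInvariant {d : ℕ} {α : Type*} [MeasurableSpace α]
    (μ : Measure ((Fin d → ℤ) → α)) : Prop :=
  ∀ n : Fin d → ℤ, MeasurePreserving (shift n) μ μ

/-- Height functions on `ℤ^d`: graph homomorphisms from `ℤ^d` to the Cayley graph of `ℤ`. -/
def heightFunctions (d : ℕ) : Set ((Fin d → ℤ) → ℤ) :=
  {h | ∀ n m, (lattice d).Adj n m → |h n - h m| = 1}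

/-- The subshift `X_r` of `(ℤ/rℤ)^(ℤ^d)`: reductions modulo `r` of height functions. -/
def Xr (d r : ℕ) : Set ((Fin d → ℤ) → ZMod r) :=
  (fun h n => (h n : ZMod r)) '' heightFunctions d

end MRF

open Filter Topology

namespace MRF

/-! ### Height functions: Lipschitz and lattice structure, splicing, local extrema. -/

section Heights

variable {d : ℕ}

/-! A non-frozen point of the support has a local extremum
(`exists_local_extremum_of_not_isFrozenPoint`), so `extremalAtZero` has positive measure. By
Poincaré recurrence, some point of the support meets such extrema infinitely often along each of the
`2d` coordinate rays. Each one costs its lift `h` two units of slope, so outside a large box `h`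
lies deep inside the `ℓ¹`-cone at the origin (`exists_box_of_rays`). This leaves room to splice any
height function of the right parity into `h` on any ball (`exists_splice`). Adaptedness keeps the
spliced points in the support, which is closed and hence all of `X_r`. -/

/-- The `ℓ¹`-norm on `ℤ^d`. -/
def l1norm (u : Fin d → ℤ) : ℤ := ∑ i, |u i|

lemma lattice_adj_iff {u v : Fin d → ℤ} : (lattice d).Adj u v ↔ l1norm (u - v) = 1 := Iff.rfl

lemma l1norm_single (i : Fin d) (s : ℤ) : l1norm (Pi.single i s : Fin d → ℤ) = |s| := by
  unfold l1norm
  rw [Finset.sum_eq_single i]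
  · simp
  · intro j _ hj
    simp [Pi.single_eq_of_ne hj]
  · simp

lemma l1norm_nonneg (u : Fin d → ℤ) : 0 ≤ l1norm u :=
  Finset.sum_nonneg fun _ _ => abs_nonneg _

lemma l1norm_neg (u : Fin d → ℤ) : l1norm (-u) = l1norm u := by
  simp [l1norm]

lemma abs_le_l1norm (u : Fin d → ℤ) (i : Fin d) : |u i| ≤ l1norm u :=
  Finset.single_le_sum (f := fun i => |u i|) (fun _ _ => abs_nonneg _) (Finset.mem_univ i)

lemma eq_zero_of_l1norm_eq_zero {u : Fin d → ℤ} (h : l1norm u = 0) : u = 0 := by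
  ext i
  have := abs_le_l1norm u i
  rw [h] at this
  simpa using this

lemma l1norm_sub_single (u : Fin d → ℤ) (i : Fin d) (s : ℤ) :
    l1norm (u - Pi.single i s) = l1norm u - |u i| + |u i - s| := by
  unfold l1norm
  rw [← Finset.add_sum_erase _ _ (Finset.mem_univ i),
    ← Finset.add_sum_erase (a := i) _ (fun i => |u i|) (Finset.mem_univ i)]
  have : ∑ j ∈ Finset.univ.erase i, |(u - Pi.single i s : Fin d → ℤ) j|
      = ∑ j ∈ Finset.univ.erase i, |u j| := by
    refine Finset.sum_congr rfl fun j hj => ?_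
    simp [Pi.single_eq_of_ne (Finset.ne_of_mem_erase hj)]
  rw [this]
  simp only [Pi.sub_apply, Pi.single_eq_same]
  ring

lemma adj_add_single (u : Fin d → ℤ) (i : Fin d) {s : ℤ} (hs : |s| = 1) :
    (lattice d).Adj u (u + Pi.single i s) := by
  rw [lattice_adj_iff, sub_add_cancel_left, l1norm_neg, l1norm_single, hs]

lemma exists_adj_closer {u v : Fin d → ℤ} (h : u ≠ v) :
    ∃ w, (lattice d).Adj u w ∧ l1norm (w - v) = l1norm (u - v) - 1 := by
  obtain ⟨i, hi⟩ := Function.ne_iff.1 h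
  have hne : (u - v) i ≠ 0 := sub_ne_zero.2 hi
  have key : ∀ s : ℤ, |s| = 1 → |(u - v) i - s| = |(u - v) i| - 1 →
      ∃ w, (lattice d).Adj u w ∧ l1norm (w - v) = l1norm (u - v) - 1 := by
    intro s hs hs'
    refine ⟨u + Pi.single i (-s), adj_add_single u i (by rwa [abs_neg]), ?_⟩
    rw [show u + Pi.single i (-s) - v = (u - v) - Pi.single i s by
      rw [Pi.single_neg]; abel, l1norm_sub_single, hs']
    ring
  rcases lt_or_gt_of_ne hne with hlt | hgt
  · exact key (-1) (by simp) (by rw [abs_of_neg hlt, abs_of_nonpos (by omega)]; omega)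
  · exact key 1 (by simp) (by rw [abs_of_pos hgt, abs_of_nonneg (by omega)])

lemma heightFunctions_lipschitz_parity {h : (Fin d → ℤ) → ℤ} (hh : h ∈ heightFunctions d)
    (u v : Fin d → ℤ) :
    |h u - h v| ≤ l1norm (u - v) ∧ (2 : ℤ) ∣ h u - h v - l1norm (u - v) := by
  obtain ⟨n, hn⟩ := Int.eq_ofNat_of_zero_le (l1norm_nonneg (u - v))
  induction n generalizing u with
  | zero =>
    have := eq_zero_of_l1norm_eq_zero hn
    rw [sub_eq_zero] at this
    subst this
    simp [l1norm]
  | succ n ih =>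
    have huv : u ≠ v := by
      rintro rfl
      simp [l1norm] at hn
      omega
    obtain ⟨w, hw, hwv⟩ := exists_adj_closer huv
    have h1 := ih w (by rw [hwv, hn]; push_cast; ring)
    have h2 := hh u w hw
    rw [abs_eq (by norm_num)] at h2
    rw [abs_le] at h1 ⊢
    omega

lemma heightFunctions_lipschitz {h : (Fin d → ℤ) → ℤ} (hh : h ∈ heightFunctions d)
    (u v : Fin d → ℤ) : |h u - h v| ≤ l1norm (u - v) :=
  (heightFunctions_lipschitz_parity hh u v).1

lemma two_dvd_sub_of_two_dvd_sub_zero {g h : (Fin d → ℤ) → ℤ} (hg : g ∈ heightFunctions d)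
    (hh : h ∈ heightFunctions d) (h0 : (2 : ℤ) ∣ g 0 - h 0) (u : Fin d → ℤ) :
    (2 : ℤ) ∣ g u - h u := by
  have h1 := (heightFunctions_lipschitz_parity hg u 0).2
  have h2 := (heightFunctions_lipschitz_parity hh u 0).2
  omega

/-- Equal parity makes `g - h` even everywhere, so the two graphs cannot cross strictly along an
edge. -/
lemma max_mem_heightFunctions {g h : (Fin d → ℤ) → ℤ} (hg : g ∈ heightFunctions d)
    (hh : h ∈ heightFunctions d) (h0 : (2 : ℤ) ∣ g 0 - h 0) :
    (fun u => max (g u) (h u)) ∈ heightFunctions d := by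
  intro n m hnm
  have h1 := hg n m hnm
  have h2 := hh n m hnm
  have h3 := two_dvd_sub_of_two_dvd_sub_zero hg hh h0 n
  rw [abs_eq (by norm_num)] at h1 h2 ⊢
  dsimp only
  omega

lemma neg_mem_heightFunctions {h : (Fin d → ℤ) → ℤ} (hh : h ∈ heightFunctions d) :
    -h ∈ heightFunctions d := by
  intro n m hnm
  have := hh n m hnm
  rw [abs_sub_comm] at this
  rw [← this]
  congr 1
  simp only [Pi.neg_apply]
  ring

lemma min_mem_heightFunctions {g h : (Fin d → ℤ) → ℤ} (hg : g ∈ heightFunctions d)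
    (hh : h ∈ heightFunctions d) (h0 : (2 : ℤ) ∣ g 0 - h 0) :
    (fun u => min (g u) (h u)) ∈ heightFunctions d := by
  have := neg_mem_heightFunctions (max_mem_heightFunctions (neg_mem_heightFunctions hg)
    (neg_mem_heightFunctions hh) (by simp only [Pi.neg_apply]; omega))
  convert this using 1
  ext u
  simp only [Pi.neg_apply]
  omega

lemma add_const_mem_heightFunctions {h : (Fin d → ℤ) → ℤ} (hh : h ∈ heightFunctions d) (c : ℤ) :
    (fun u => h u + c) ∈ heightFunctions d := by
  intro n m hnm
  simpa using hh n m hnm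

lemma shift_mem_heightFunctions {h : (Fin d → ℤ) → ℤ} (hh : h ∈ heightFunctions d)
    (a : Fin d → ℤ) : shift a h ∈ heightFunctions d := by
  intro n m hnm
  refine hh _ _ ?_
  rw [lattice_adj_iff] at hnm ⊢
  rwa [add_sub_add_right_eq_sub]

lemma l1norm_mem_heightFunctions : (l1norm : (Fin d → ℤ) → ℤ) ∈ heightFunctions d := by
  intro n m hnm
  rw [lattice_adj_iff] at hnm
  have h1 : ∀ a b : Fin d → ℤ, l1norm a ≤ l1norm b + l1norm (a - b) := by
    intro a b
    unfold l1norm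
    rw [← Finset.sum_add_distrib]
    refine Finset.sum_le_sum fun i _ => ?_
    simpa using abs_add_le (b i) (a i - b i)
  have h2 : (2 : ℤ) ∣ l1norm n - l1norm m - l1norm (n - m) := by
    unfold l1norm
    rw [← Finset.sum_sub_distrib, ← Finset.sum_sub_distrib]
    refine Finset.dvd_sum fun i _ => ?_
    rw [Pi.sub_apply]
    rcases abs_choice (n i) with h2 | h2 <;> rcases abs_choice (m i) with h3 | h3 <;>
      rcases abs_choice (n i - m i) with h4 | h4 <;> rw [h2, h3, h4] <;> omega
  have h3 := h1 n m
  have h4 := h1 m n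
  rw [← neg_sub n m, l1norm_neg] at h4
  rw [abs_eq (by norm_num)]
  omega

/-- A height function `p` with `p 0` close to `h 0` and of the same parity can be spliced into `h`
near the origin if `h` stays well inside the `ℓ¹`-cone at `0` outside a box. -/
lemma exists_splice {h p : (Fin d → ℤ) → ℤ} (hh : h ∈ heightFunctions d)
    (hp : p ∈ heightFunctions d) (h0 : (2 : ℤ) ∣ h 0 - p 0) {n K L : ℤ}
    (hK : n + n + |h 0 - p 0| ≤ 2 * K)
    (hL : ∀ u, (∃ i, L ≤ |u i|) → |h u - h 0| ≤ l1norm u - 2 * K) :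
    ∃ g ∈ heightFunctions d, (∀ u, l1norm u ≤ n → g u = p u) ∧
      ∀ u, (∃ i, L ≤ |u i|) → g u = h u := by
  have z : l1norm (0 : Fin d → ℤ) = 0 := by simp [l1norm]
  -- Clamp `h` between `p` cut from below by an upward cone and `p` cut from above by a downward
  -- cone. On the ball both cuts equal `p`; outside the box `h` already lies between them.
  have hhi := max_mem_heightFunctions hp
    (add_const_mem_heightFunctions l1norm_mem_heightFunctions (h 0 - 2 * K)) (by rw [z]; omega)
  have hlo := min_mem_heightFunctions hp (add_const_mem_heightFunctions
    (neg_mem_heightFunctions l1norm_mem_heightFunctions) (h 0 + 2 * K))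
    (by simp only [Pi.neg_apply]; rw [z]; omega)
  have hm := min_mem_heightFunctions hh hhi (by rw [z]; omega)
  refine ⟨_, max_mem_heightFunctions hlo hm
    (by simp only [Pi.neg_apply]; rw [z]; omega), fun u hu => ?_, fun u hu => ?_⟩
  · have := heightFunctions_lipschitz hp u 0
    rw [sub_zero] at this
    simp only [Pi.neg_apply]
    have h3 := abs_le.1 this
    have h4 := abs_le.1 (le_refl |h 0 - p 0|)
    omega
  · have := abs_le.1 (hL u hu)
    simp only [Pi.neg_apply]
    omega

/-- Along a `±1`-path that backtracks infinitely often, the distance to the starting value falls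
short of the length by an arbitrarily large amount. -/
lemma exists_forall_abs_sub_le_of_frequently {f : ℕ → ℤ} (hf : ∀ k, |f (k + 1) - f k| = 1)
    (hr : ∃ᶠ k in atTop, f (k + 2) = f k) (K : ℕ) :
    ∃ L₀ : ℕ, ∀ L ≥ L₀, |f L - f 0| ≤ L - 2 * K := by
  induction K with
  | zero =>
    refine ⟨0, fun L _ => ?_⟩
    induction L with
    | zero => simp
    | succ L ih =>
      have := abs_le.1 (hf L).le
      have ih := abs_le.1 (ih (Nat.zero_le _))
      rw [abs_le]
      push_cast at *
      omega
  | succ K ih =>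
    obtain ⟨L₀, hL₀⟩ := ih
    obtain ⟨k, hk, hfk⟩ := (frequently_atTop.1 hr) L₀
    -- The backtrack at `k` adds two steps but no displacement, gaining the extra `2`; later steps
    -- cannot lose it.
    refine ⟨k + 2, fun L hL => ?_⟩
    induction L, hL using Nat.le_induction with
    | base =>
      have := hL₀ k hk
      rw [hfk]
      push_cast
      linarith
    | succ L hL ih =>
      have := abs_le.1 (hf L).le
      have ih := abs_le.1 ih
      rw [abs_le]
      push_cast at *
      omega

/-- If the graphs of two height functions differ, one above the other on a finite nonempty set,
then the lower one has a local minimum. -/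
lemma exists_local_extremum_of_lt {h g : (Fin d → ℤ) → ℤ} (hh : h ∈ heightFunctions d)
    (hg : g ∈ heightFunctions d) (hfin : {v | h v < g v}.Finite) (hne : {v | h v < g v}.Nonempty) :
    ∃ v, ∀ i, h (v + (Pi.single i 1 : Fin d → ℤ)) =
      h (v + (Pi.single i (-1) : Fin d → ℤ)) := by
  -- A neighbour with smaller `h` would still satisfy `h < g`, contradicting minimality.
  obtain ⟨v, hv, hmin⟩ := Set.exists_min_image _ h hfin hne
  have key : ∀ w, (lattice d).Adj v w → h w = h v + 1 := by
    intro w hw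
    have h1 := hh v w hw
    have h2 := hg v w hw
    have h3 : h w < g w → h v ≤ h w := hmin w
    have h4 : h v < g v := hv
    rw [abs_eq (by norm_num)] at h1 h2
    omega
  exact ⟨v, fun i => by
    rw [key _ (adj_add_single v i (by simp)), key _ (adj_add_single v i (by simp))]⟩

lemma exists_local_extremum {h g : (Fin d → ℤ) → ℤ} (hh : h ∈ heightFunctions d)
    (hg : g ∈ heightFunctions d) (hfin : {v | h v ≠ g v}.Finite) (hne : h ≠ g) :
    ∃ v, ∀ i, h (v + (Pi.single i 1 : Fin d → ℤ)) =
      h (v + (Pi.single i (-1) : Fin d → ℤ)) := by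
  obtain ⟨v, hv⟩ := Function.ne_iff.1 hne
  rcases lt_or_gt_of_ne hv with hlt | hgt
  · exact exists_local_extremum_of_lt hh hg (hfin.subset fun w hw => ne_of_lt hw) ⟨v, hlt⟩
  · obtain ⟨w, hw⟩ := exists_local_extremum_of_lt (neg_mem_heightFunctions hh)
      (neg_mem_heightFunctions hg)
      (hfin.subset fun w hw => ne_of_gt (neg_lt_neg_iff.1 hw)) ⟨v, neg_lt_neg hgt⟩
    exact ⟨w, fun i => neg_injective (hw i)⟩

/-- The complement of a box in `ℤ^d`, `d ≥ 2`, is connected. -/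
lemma eq_const_of_locally_const_off_box {β : Type*} (hd : 2 ≤ d) {M : ℤ} (hM : 0 ≤ M)
    {f : (Fin d → ℤ) → β}
    (hf : ∀ n m, (lattice d).Adj n m → (∃ i, M < |n i|) → (∃ i, M < |m i|) → f n = f m)
    (u : Fin d → ℤ) (hu : ∃ i, M < |u i|) : f u = f fun _ => M + 1 := by
  have line : ∀ (u : Fin d → ℤ) (i j : Fin d), i ≠ j → M < |u i| → ∀ t,
      f (Function.update u j t) = f u := by
    intro u i j hij hi
    have hstep : ∀ t, f (Function.update u j (t + 1)) = f (Function.update u j t) := by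
      intro t
      have hadj := adj_add_single (Function.update u j t) j (s := 1) (by simp)
      have : Function.update u j t + Pi.single j 1 = Function.update u j (t + 1) := by
        ext k
        by_cases hk : k = j
        · subst hk; simp
        · simp [hk]
      rw [this] at hadj
      exact (hf _ _ hadj ⟨i, by simpa [hij] using hi⟩ ⟨i, by simpa [hij] using hi⟩).symm
    have hconst : ∀ t, f (Function.update u j t) = f (Function.update u j 0) := by
      intro t
      induction t with
      | zero => rfl
      | succ k ih => rw [hstep, ih]
      | pred k ih => rw [← ih, ← hstep, sub_add_cancel]
    intro t
    rw [hconst t, ← hconst (u j), Function.update_eq_self]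
  obtain ⟨i, hi⟩ := hu
  -- Coordinate `i` keeps the path outside the box while the others move to `M + 1`; then another
  -- one takes over while `i` moves.
  have hmove : ∀ s : Finset (Fin d), i ∉ s → f (s.piecewise (fun _ => M + 1) u) = f u := by
    intro s
    induction s using Finset.induction_on with
    | empty => simp
    | insert j s hj ih =>
      intro his
      rw [Finset.mem_insert, not_or] at his
      rw [Finset.piecewise_insert, line _ i j his.1 (by simpa [his.2] using hi), ih his.2]
  have : Nontrivial (Fin d) := Fin.nontrivial_iff_two_le.2 hd
  obtain ⟨j, hj⟩ := exists_ne i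
  rw [← hmove (Finset.univ.erase i) (by simp),
    ← line _ j i hj (by simp [hj]; rw [abs_of_nonneg] <;> omega) (M + 1)]
  congr 1
  ext k
  by_cases hk : k = i
  · subst hk; simp
  · simp [hk]

end Heights

/-! ### Configurations modulo `r`: lifts, recurrence and the support. -/

section Configurations

variable {d r : ℕ}

lemma eq_of_intCast_eq_of_abs_le (hr : 3 ≤ r) {a b : ℤ} (h : (a : ZMod r) = b)
    (hab : |a - b| ≤ 2) : a = b := by
  have h1 : (r : ℤ) ∣ b - a := (ZMod.intCast_eq_intCast_iff_dvd_sub a b r).1 h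
  have := Int.eq_zero_of_abs_lt_dvd h1 (by rw [abs_sub_comm]; omega)
  omega

lemma exists_local_extremum_of_not_isFrozenPoint (hd : 2 ≤ d) (hr : 3 ≤ r)
    {x : (Fin d → ℤ) → ZMod r} (hx : x ∈ Xr d r) (hnf : ¬ IsFrozenPoint (Xr d r) x) :
    ∃ v, ∀ i, x (v + (Pi.single i 1 : Fin d → ℤ)) =
      x (v + (Pi.single i (-1) : Fin d → ℤ)) := by
  obtain ⟨y, hy, hyx⟩ : ∃ y, Homoclinic (Xr d r) x y ∧ y ≠ x := by
    by_contra! hcon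
    refine hnf (Set.eq_singleton_iff_unique_mem.2 ⟨⟨hx, hx, by simp⟩, hcon⟩)
  obtain ⟨h, hh, rfl⟩ := hx
  obtain ⟨-, ⟨g, hg, rfl⟩, hfin⟩ := hy
  dsimp only at hfin ⊢
  obtain ⟨M, hM0, hM⟩ : ∃ M : ℤ, 0 ≤ M ∧
      ∀ v, (∃ i, M < |v i|) → (h v : ZMod r) = g v := by
    obtain ⟨M, hM⟩ := (hfin.image l1norm).bddAbove
    refine ⟨max M 0, le_max_right _ _, fun v ⟨i, hi⟩ => ?_⟩
    by_contra hne
    have h1 : l1norm v ≤ M := hM ⟨v, hne, rfl⟩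
    have h2 := abs_le_l1norm v i
    have h3 := le_max_left M 0
    omega
  -- Off the box the increments of both lifts agree mod `r`, hence exactly as `r ≥ 3`. So the lifts
  -- differ there by a constant multiple of `r`, which can be subtracted.
  have hconst := eq_const_of_locally_const_off_box hd hM0 (f := fun v => g v - h v) (by
    intro n m hnm hn hm
    have h1 := hh n m hnm
    have h2 := hg n m hnm
    have h3 : ((g n - g m : ℤ) : ZMod r) = ((h n - h m : ℤ) : ZMod r) := by
      push_cast
      rw [hM n hn, hM m hm]
    have h4 := eq_of_intCast_eq_of_abs_le hr h3 (by
      have := abs_sub (g n - g m) (h n - h m)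
      omega)
    omega)
  set c := g (fun _ => M + 1) - h fun _ => M + 1 with hc
  have hc0 : (c : ZMod r) = 0 := by
    rw [hc]
    push_cast
    rw [hM, sub_self]
    exact ⟨⟨0, by omega⟩, by rw [abs_of_nonneg] <;> omega⟩
  obtain ⟨v, hv⟩ := exists_local_extremum hh (add_const_mem_heightFunctions hg (-c)) (by
    refine (Set.finite_Icc (fun _ : Fin d => -M) fun _ => M).subset fun v hv => ?_
    have : ∀ i, |v i| ≤ M := by
      by_contra! hcon
      have := hconst v hcon
      exact hv (by omega)
    exact ⟨fun i => (abs_le.1 (this i)).1, fun i => (abs_le.1 (this i)).2⟩) (by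
    intro heq
    refine hyx (funext fun v => ?_)
    have : (h v : ZMod r) = ((g v + -c : ℤ) : ZMod r) := by
      rw [congrFun heq v]
    push_cast [hc0] at this
    simpa using this.symm)
  exact ⟨v, fun i => by rw [hv i]⟩

lemma iterate_shift {α : Type*} (n : Fin d → ℤ) (k : ℕ) (x : (Fin d → ℤ) → α) :
    (shift n)^[k] x = shift (k • n) x := by
  induction k with
  | zero => ext m; simp [shift]
  | succ k ih =>
    rw [Function.iterate_succ_apply', ih]
    ext m
    simp only [shift, succ_nsmul]
    congr 1
    abel

/-- The set of configurations taking, in every direction, the same value at both neighbours of the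
origin. For `x ∈ X_r` these are the configurations with a local extremum at the origin. -/
def extremalAtZero (d r : ℕ) : Set ((Fin d → ℤ) → ZMod r) :=
  {x | ∀ i : Fin d, x (Pi.single i 1) = x (Pi.single i (-1))}

lemma isOpen_setOf_apply_eq (a b : Fin d → ℤ) :
    IsOpen {x : (Fin d → ℤ) → ZMod r | x a = x b} := by
  have : Continuous fun x : (Fin d → ℤ) → ZMod r => (x a, x b) := by fun_prop
  exact (isOpen_discrete {p : ZMod r × ZMod r | p.1 = p.2}).preimage this

/-- A height function whose reduction returns infinitely often to `extremalAtZero` along a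
coordinate ray falls short of the maximal slope along this ray. -/
lemma exists_forall_ray_le (hr : 3 ≤ r) {h : (Fin d → ℤ) → ℤ} (hh : h ∈ heightFunctions d)
    (i : Fin d) {s : ℤ} (hs : s = 1 ∨ s = -1)
    (hrec : ∃ᶠ k in atTop, (shift (Pi.single i s))^[k] (fun n => (h n : ZMod r)) ∈
      extremalAtZero d r) (K : ℕ) :
    ∃ L₀ : ℕ, ∀ L ≥ L₀, |h (Pi.single i (s * L)) - h 0| ≤ L - 2 * K := by
  have hs1 : |s| = 1 := by rcases hs with rfl | rfl <;> simp
  have hstep : ∀ k : ℕ,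
      |h (Pi.single i (s * ((k + 1 : ℕ) : ℤ))) - h (Pi.single i (s * (k : ℤ)))| = 1 := by
    intro k
    refine hh _ _ (SimpleGraph.Adj.symm ?_)
    convert adj_add_single (Pi.single i (s * (k : ℤ))) i hs1 using 1
    rw [← Pi.single_add]
    push_cast
    ring_nf
  obtain ⟨L₀, hL₀⟩ := exists_forall_abs_sub_le_of_frequently
    (f := fun k : ℕ => h (Pi.single i (s * (k : ℤ)))) hstep (by
      rw [frequently_atTop] at hrec ⊢
      intro a
      -- An extremum at distance `k + 1` equates the values at `k` and `k + 2`, hence the index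
      -- shift.
      obtain ⟨k, hk, hmem⟩ := hrec (a + 1)
      obtain ⟨k, rfl⟩ : ∃ j, k = j + 1 := ⟨k - 1, by omega⟩
      refine ⟨k, by omega, ?_⟩
      rw [iterate_shift] at hmem
      have h1 := hmem i
      simp only [shift, ← Pi.single_smul, ← Pi.single_add] at h1
      have h2 : (h (Pi.single i (s * ((k + 2 : ℕ) : ℤ))) : ZMod r)
          = h (Pi.single i (s * (k : ℤ))) := by
        rcases hs with rfl | rfl
        · rw [show (1 : ℤ) * ((k + 2 : ℕ) : ℤ) = 1 + (k + 1) • 1 by simp; ring,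
            show (1 : ℤ) * (k : ℤ) = -1 + (k + 1) • 1 by simp, h1]
        · rw [show (-1 : ℤ) * ((k + 2 : ℕ) : ℤ) = -1 + (k + 1) • (-1) by simp; ring,
            show (-1 : ℤ) * (k : ℤ) = 1 + (k + 1) • (-1) by simp, h1]
      refine eq_of_intCast_eq_of_abs_le hr h2 ?_
      have h3 := hstep k
      have h4 := hstep (k + 1)
      have h5 := abs_sub_le (h (Pi.single i (s * ((k + 2 : ℕ) : ℤ))))
        (h (Pi.single i (s * ((k + 1 : ℕ) : ℤ)))) (h (Pi.single i (s * (k : ℤ))))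
      have h6 : k + 1 + 1 = k + 2 := rfl
      rw [h6] at h4
      omega) K
  exact ⟨L₀, fun L hL => by simpa using hL₀ L hL⟩

/-- If `h` falls short of the maximal slope along all coordinate rays, then it stays well inside
the `ℓ¹`-cone outside a box. -/
lemma exists_box_of_rays {h : (Fin d → ℤ) → ℤ} (hh : h ∈ heightFunctions d) (K : ℕ)
    (hray : ∀ i : Fin d, ∀ s : ℤ, s = 1 ∨ s = -1 →
      ∃ L₀ : ℕ, ∀ L ≥ L₀, |h (Pi.single i (s * (L : ℕ))) - h 0| ≤ L - 2 * K) :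
    ∃ L : ℤ, ∀ u, (∃ i, L ≤ |u i|) → |h u - h 0| ≤ l1norm u - 2 * K := by
  choose! L₀ hL₀ using hray
  refine ⟨∑ i, ((L₀ i 1 : ℤ) + L₀ i (-1)), fun u ⟨i, hi⟩ => ?_⟩
  have h1 : (L₀ i 1 : ℤ) + L₀ i (-1) ≤ |u i| :=
    (Finset.single_le_sum (f := fun i => (L₀ i 1 : ℤ) + L₀ i (-1))
      (fun _ _ => by positivity) (Finset.mem_univ i)).trans hi
  have key : ∀ s : ℤ, s = 1 ∨ s = -1 → (L₀ i s : ℤ) ≤ |u i| → u i = s * |u i| →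
      |h u - h 0| ≤ l1norm u - 2 * K := by
    intro s hs hle hu
    have h2 := hL₀ i s hs (u i).natAbs (by rw [← Int.natCast_natAbs] at hle; omega)
    rw [Int.natCast_natAbs, ← hu] at h2
    -- From the ray point to `u`, the height changes by at most the `ℓ¹`-size of the other
    -- coordinates, so the deficit survives.
    have h3 := heightFunctions_lipschitz hh u (Pi.single i (u i))
    rw [l1norm_sub_single, sub_self, abs_zero] at h3
    have h4 := abs_sub_le (h u) (h (Pi.single i (u i))) (h 0)
    omega
  rcases le_total 0 (u i) with h0 | h0
  · exact key 1 (Or.inl rfl) (by omega) (by rw [abs_of_nonneg h0, one_mul])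
  · exact key (-1) (Or.inr rfl) (by omega) (by rw [abs_of_nonpos h0]; ring)

lemma exists_homoclinic_eq_on_ball (hr : 3 ≤ r) {h p : (Fin d → ℤ) → ℤ}
    (hh : h ∈ heightFunctions d) (hp : p ∈ heightFunctions d) (h0 : (2 : ℤ) ∣ h 0 - p 0)
    (hrec : ∀ i : Fin d, ∀ s : ℤ, s = 1 ∨ s = -1 →
      ∃ᶠ k in atTop, (shift (Pi.single i s))^[k] (fun n => (h n : ZMod r)) ∈
        extremalAtZero d r) (n : ℕ) :
    ∃ y, Homoclinic (Xr d r) (fun n => (h n : ZMod r)) y ∧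
      ∀ u, l1norm u ≤ n → y u = p u := by
  set K : ℕ := n + (h 0 - p 0).natAbs with hK
  obtain ⟨L, hL⟩ := exists_box_of_rays hh K
    fun i s hs => exists_forall_ray_le hr hh i hs (hrec i s hs) K
  obtain ⟨g, hg, hgp, hgh⟩ := exists_splice hh hp h0 (n := n) (K := K) (L := L)
    (by have := abs_nonneg (h 0 - p 0); rw [hK]; push_cast; omega) hL
  refine ⟨fun n => (g n : ZMod r), ⟨⟨h, hh, rfl⟩, ⟨g, hg, rfl⟩, ?_⟩, fun u hu => ?_⟩
  · refine (Set.finite_Icc (fun _ : Fin d => -L) fun _ => L).subset fun v hv => ?_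
    have : ∀ i, |v i| ≤ L := by
      by_contra! hcon
      obtain ⟨i, hi⟩ := hcon
      exact hv (by dsimp only; rw [hgh v ⟨i, hi.le⟩])
    exact ⟨fun i => (abs_le.1 (this i)).1, fun i => (abs_le.1 (this i)).2⟩
  · dsimp only
    rw [hgp u hu]

lemma shift_mem_support {μ : Measure ((Fin d → ℤ) → ZMod r)} (hinv : IsShiftInvariant μ)
    [OpensMeasurableSpace ((Fin d → ℤ) → ZMod r)]
    (n : Fin d → ℤ) {x : (Fin d → ℤ) → ZMod r} (hx : x ∈ μ.support) : shift n x ∈ μ.support := by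
  rw [Measure.mem_support_iff_forall] at hx ⊢
  intro U hU
  obtain ⟨V, hVU, hV, hxV⟩ := mem_nhds_iff.1 hU
  have hcont : Continuous (shift n : ((Fin d → ℤ) → ZMod r) → _) := by
    unfold shift
    fun_prop
  have := hx _ ((hV.preimage hcont).mem_nhds hxV)
  rw [(hinv n).measure_preimage hV.measurableSet.nullMeasurableSet] at this
  exact this.trans_le (measure_mono hVU)

lemma mem_of_forall_exists_eq_on_ball {S : Set ((Fin d → ℤ) → ZMod r)} (hS : IsClosed S)
    {x : (Fin d → ℤ) → ZMod r}
    (h : ∀ n : ℕ, ∃ y ∈ S, ∀ u, l1norm u ≤ n → y u = x u) : x ∈ S := by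
  choose y hyS hy using h
  refine hS.mem_of_tendsto (f := y) (b := atTop) ?_ (Eventually.of_forall hyS)
  rw [tendsto_pi_nhds]
  intro u
  refine tendsto_const_nhds.congr' ?_
  filter_upwards [eventually_ge_atTop (l1norm u).toNat] with n hn
  exact (hy n u (by omega)).symm

lemma ae_frequently_extremalAtZero {μ : Measure ((Fin d → ℤ) → ZMod r)} [IsFiniteMeasure μ]
    [OpensMeasurableSpace ((Fin d → ℤ) → ZMod r)] (hinv : IsShiftInvariant μ) :
    ∀ᵐ x ∂μ, x ∈ extremalAtZero d r → ∀ i : Fin d, ∀ s : ℤ,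
      ∃ᶠ k in atTop, (shift (Pi.single i s))^[k] x ∈ extremalAtZero d r := by
  have hmeas : NullMeasurableSet (extremalAtZero d r) μ := by
    rw [extremalAtZero, Set.ofPred_forall]
    exact (MeasurableSet.iInter fun i =>
      (isOpen_setOf_apply_eq _ _).measurableSet).nullMeasurableSet
  have : ∀ i : Fin d, ∀ s : ℤ, ∀ᵐ x ∂μ, x ∈ extremalAtZero d r →
      ∃ᶠ k in atTop, (shift (Pi.single i s))^[k] x ∈ extremalAtZero d r := fun i s =>
    (hinv (Pi.single i s)).conservative.ae_mem_imp_frequently_image_mem hmeas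
  simp_rw [← ae_all_iff] at this
  filter_upwards [this] with x hx hxA i s using hx i s hxA

lemma measure_extremalAtZero_pos (hd : 2 ≤ d) (hr : 3 ≤ r)
    {μ : Measure ((Fin d → ℤ) → ZMod r)} [OpensMeasurableSpace ((Fin d → ℤ) → ZMod r)]
    (hinv : IsShiftInvariant μ) {x : (Fin d → ℤ) → ZMod r} (hxs : x ∈ μ.support)
    (hx : x ∈ Xr d r) (hnf : ¬ IsFrozenPoint (Xr d r) x) : 0 < μ (extremalAtZero d r) := by
  obtain ⟨v, hv⟩ := exists_local_extremum_of_not_isFrozenPoint hd hr hx hnf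
  have hopen : IsOpen (extremalAtZero d r) := by
    rw [extremalAtZero, Set.ofPred_forall]
    exact isOpen_iInter_of_finite fun i => isOpen_setOf_apply_eq _ _
  have hmem : shift v x ∈ extremalAtZero d r := by
    intro i
    simpa only [shift, add_comm] using hv i
  exact (Measure.mem_support_iff_forall _).1 (shift_mem_support hinv v hxs) _
    (hopen.mem_nhds hmem)

lemma support_eq_of_measure_extremalAtZero_pos (hd : 0 < d) (hr : 3 ≤ r)
    {μ : Measure ((Fin d → ℤ) → ZMod r)} [IsFiniteMeasure μ]
    [OpensMeasurableSpace ((Fin d → ℤ) → ZMod r)]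
    [HereditarilyLindelofSpace ((Fin d → ℤ) → ZMod r)]
    (hinv : IsShiftInvariant μ) (had : IsAdapted (Xr d r) μ)
    (hpos : 0 < μ (extremalAtZero d r)) : μ.support = Xr d r := by
  obtain ⟨x, hxA, hxs, hrec⟩ := ((frequently_ae_mem_iff.2 hpos.ne').and_eventually
    (Filter.Eventually.and (p := (· ∈ μ.support)) Measure.support_mem_ae (ae_frequently_extremalAtZero hinv))).exists
  replace hrec := hrec hxA
  obtain ⟨h, hh, rfl⟩ := had.1 hxs
  have main : ∀ p ∈ heightFunctions d, (2 : ℤ) ∣ h 0 - p 0 → ∀ n : ℕ,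
      ∃ y ∈ μ.support, ∀ u, l1norm u ≤ n → y u = p u := by
    intro p hp h0 n
    obtain ⟨y, hy, hyp⟩ := exists_homoclinic_eq_on_ball hr hh hp h0 (fun i s _ => hrec i s) n
    exact ⟨y, had.2 _ hxs y hy, hyp⟩
  refine had.1.antisymm ?_
  rintro _ ⟨p, hp, rfl⟩
  refine mem_of_forall_exists_eq_on_ball Measure.isClosed_support fun n => ?_
  by_cases h0 : (2 : ℤ) ∣ h 0 - p 0
  · exact main p hp h0 n
  -- A unit shift of `p` flips its parity; shifting back costs one unit of radius.
  · set e : Fin d → ℤ := Pi.single ⟨0, hd⟩ 1 with he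
    have h1 : |p 0 - p (-e)| = 1 := hp _ _ (by
      have := adj_add_single (0 : Fin d → ℤ) ⟨0, hd⟩ (s := -1) (by simp)
      rwa [zero_add, Pi.single_neg] at this)
    obtain ⟨y, hy, hyp⟩ := main (shift (-e) p) (shift_mem_heightFunctions hp _) (by
      rw [shift, zero_add]
      rw [abs_eq (by norm_num)] at h1
      omega) (n + 1)
    refine ⟨shift e y, shift_mem_support hinv e hy, fun u hu => ?_⟩
    have h2 : l1norm (u + e) ≤ n + 1 := by
      have := abs_le.1 (heightFunctions_lipschitz l1norm_mem_heightFunctions (u + e) u)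
      rw [add_sub_cancel_left, show l1norm e = 1 by rw [he, l1norm_single, abs_one]] at this
      omega
    rw [shift, hyp _ (by push_cast; exact h2), shift, add_neg_cancel_right]

end Configurations

end MRF

theorem mainTheorem2 (d : ℕ) (hd : 2 ≤ d) (r : ℕ) (hr0 : 0 < r) (hr1 : r ≠ 1) (hr2 : r ≠ 2)
    (hr4 : r ≠ 4) (μ : MeasureTheory.Measure ((Fin d → ℤ) → ZMod r))
    (hmrf : MRF.IsMarkovRandomField (MRF.lattice d) μ)
    (hinv : MRF.IsShiftInvariant μ)
    (had : MRF.IsAdapted (MRF.Xr d r) μ) :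
    μ.support = MRF.Xr d r ∨ MRF.IsFrozen (MRF.Xr d r) μ := by
  have : NeZero r := ⟨hr0.ne'⟩
  have : BorelSpace (ZMod r) := ⟨borel_eq_top_of_discrete.symm⟩
  have := hmrf.1
  rw [or_iff_not_imp_right, MRF.IsFrozen]
  intro hnf
  push Not at hnf
  obtain ⟨x, hxs, hx⟩ := hnf
  exact MRF.support_eq_of_measure_extremalAtZero_pos (by omega) (by omega) hinv had
    (MRF.measure_extremalAtZero_pos hd (by omega) hinv hxs (had.1 hxs) hx)
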